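/- For $A\subseteq\mathbb R^2$ let $N(\delta,A)\in\{0,1,2,\dots,\infty\}$ be the smallest number of closed discs of radius $\delta$ that cover $A$. The lower and upper box dimensions of $A$ are $\underline{\dim}_B A=\liminf_{\delta\to0+}\frac{\log N(\delta,A)}{\log(1/\delta)}$ and $\overline{\dim}_B A=\limsup_{\delta\to0+}\frac{\log N(\delta,A)}{\log(1/\delta)}$ (both are $\infty$ if $A$ is unbounded), and the packing dimension of $A$ is $\dim_P A=\inf\{\sup_i\overline{\dim}_B E_i : A\subseteq\bigcup_{i=1}^\infty E_i\}$. Let $T$ be the boundary of the square $[-1,1]\times[-1,1]$. We say that $B\subseteq\mathbb R^2$ contains an axis-parallel square boundary centered at every point of $[0,1]^2$ if for every $x\in[0,1]^2$ there is an $r>0$ such that $x+rT\subseteq B$. (i) If $B\subseteq\mathbb R^2$ contains an axis-parallel square boundary centered at every point of $[0,1]^2$, then $\underline{\dim}_B B\ge 7/4$, $\overline{\dim}_B B\ge 7/4$ and $\dim_P B\ge 7/4$. (ii) There exists a compact set $B\subseteq\mathbb R^2$ that contains an axis-parallel square boundary centered at every point of $[0,1]^2$ and satisfies $\underline{\dim}_B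 B=\overline{\dim}_B B=\dim_P B=7/4$. -/

import Mathlib

open Set Filter Topology
open scoped NNReal ENNReal

noncomputable section

/-- The plane with its Euclidean metric. -/
abbrev Plane : Type := EuclideanSpace ℝ (Fin 2)

/-- `log N(δ, A) / log (1 / δ)`, where `N(δ, A)` is the least number of closed balls of radius `δ`
that cover `A`. It is an extended real number: `N(δ, A) = ∞` gives `∞` for `δ < 1`. -/
def boxRatio {X : Type*} [PseudoEMetricSpace X] (A : Set X) (δ : ℝ≥0) : EReal :=
  ENNReal.log (Metric.externalCoveringNumber δ A : ℝ≥0∞) / ((Real.log (1 / (δ : ℝ)) : ℝ) : EReal)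

/-- Lower box (Minkowski) dimension: `liminf` of `log N(δ, A) / log (1 / δ)` as `δ → 0+`.
It is `∞` for sets that are not totally bounded, and `-∞` for the empty set. -/
def lowerBoxDim {X : Type*} [PseudoEMetricSpace X] (A : Set X) : EReal :=
  liminf (boxRatio A) (𝓝[>] (0 : ℝ≥0))

/-- Upper box (Minkowski) dimension: `limsup` of `log N(δ, A) / log (1 / δ)` as `δ → 0+`. -/
def upperBoxDim {X : Type*} [PseudoEMetricSpace X] (A : Set X) : EReal :=
  limsup (boxRatio A) (𝓝[>] (0 : ℝ≥0))

/-- Packing dimension, as modified upper box dimension: the infimum over all countable covers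
`(E i)` of `A` of the supremum of the upper box dimensions of the sets `E i`. -/
def packingDim {X : Type*} [PseudoEMetricSpace X] (A : Set X) : EReal :=
  ⨅ (E : ℕ → Set X) (_ : A ⊆ ⋃ i, E i), ⨆ i, upperBoxDim (E i)

/-- The boundary of the square `[-1, 1] × [-1, 1]`. -/
def unitSquareBoundary : Set Plane :=
  frontier {p : Plane | ∀ i, p i ∈ Icc (-1 : ℝ) 1}

/-- `B` contains the boundary of an axis-parallel (nondegenerate) square centered at every point
of `S`: for every `x ∈ S` there is `r > 0` such that `x + r T ⊆ B`, where `T` is the boundary of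
`[-1, 1] × [-1, 1]`. -/
def ContainsSquareBoundaries (B S : Set Plane) : Prop :=
  ∀ x ∈ S, ∃ r : ℝ, 0 < r ∧ (fun t : Plane => x + r • t) '' unitSquareBoundary ⊆ B

/-- The set `[0, 1] × [0, 1]` of centers. -/
def unitSquare : Set Plane :=
  {p : Plane | ∀ i, p i ∈ Icc (0 : ℝ) 1}

end

open MeasureTheory

/-! Lower bound. Suppose `n` discs of radius `δ` cover `E`, and call an axis-parallel line rich if
it meets `E` in length at least `c`. Each rich line needs about `c / δ` discs near it, so at scale
`δ` the rich lines in either direction occupy only `m ≲ δ n / c` cells. A square with rich sides is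
given by abscissas `u, v` and ordinates `p, q` with `v - u = q - p`, and its center is half the sum
of two opposite corners. The four corners lie in a grid `P` of at most `m ^ 2` cells, two on a
diagonal and two on an antidiagonal. If both lines contain more than `K` points of `P`, they
determine the center up to rounding, and there are at most `|P| / K` such lines in each direction;
otherwise the two corners on the poor line determine the center, and there are `O(K |P|)` such
pairs. With `K = m ^ (2/3)` the centers occupy `O(m ^ (8/3))` cells (`cornerSums_bound`). If the
centers have positive area, then `m ^ (8/3) δ ^ 2 ≳ 1`, which gives `n ≳ δ ^ (-7/4)`.

For the packing dimension, replace a countable cover by its increasing finite unions. For each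
center the four side lines become rich for some union with a suitable threshold, so countable
subadditivity yields a single union with a positive outer area of centers, and the bound above
applies to it.

Sharpness. Let the four side coordinates `a - R`, `a + R`, `b - R`, `b + R` have vanishing binary
digits at the places congruent to 1, 2, 3, 4 modulo 4 respectively. Each place carries one
condition, which one binary digit of `R` can meet (`exists_int_even_ediv`). The allowed coordinates
have about `8 ^ N` cells at scale `16 ^ (-N)`, that is, dimension `3/4`; segments over them give
`7/4`. -/

/-! ### Covering numbers and box dimensions -/

theorem tendsto_log_one_div_nhdsGT_zero :
    Tendsto (fun δ : ℝ≥0 => Real.log (1 / (δ : ℝ))) (𝓝[>] (0 : ℝ≥0)) atTop := by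
  have h1 : Tendsto (fun δ : ℝ≥0 => (δ : ℝ)) (𝓝[>] (0 : ℝ≥0)) (𝓝[>] (0 : ℝ)) := by
    refine tendsto_nhdsWithin_iff.2 ⟨?_, ?_⟩
    · exact (NNReal.continuous_coe.tendsto' 0 0 rfl).mono_left nhdsWithin_le_nhds
    · filter_upwards [self_mem_nhdsWithin] with δ hδ
      exact NNReal.coe_pos.2 hδ
  simp only [one_div]
  exact (Real.tendsto_log_atTop.comp tendsto_inv_nhdsGT_zero).comp h1

theorem eventually_pos_log_one_div :
    ∀ᶠ δ : ℝ≥0 in 𝓝[>] (0 : ℝ≥0), 0 < δ ∧ 0 < Real.log (1 / (δ : ℝ)) := by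
  filter_upwards [self_mem_nhdsWithin, tendsto_log_one_div_nhdsGT_zero.eventually_gt_atTop 0]
    with δ h1 h2 using ⟨h1, h2⟩

theorem log_mul_rpow_neg {c s δ : ℝ} (hc : 0 < c) (hδ : 0 < δ) :
    ENNReal.log (ENNReal.ofReal (c * δ ^ (-s))) =
      ((Real.log c + s * Real.log (1 / δ) : ℝ) : EReal) := by
  rw [ENNReal.log_ofReal_of_pos (mul_pos hc (Real.rpow_pos_of_pos hδ _)),
    Real.log_mul hc.ne' (Real.rpow_pos_of_pos hδ _).ne', Real.log_rpow hδ, one_div, Real.log_inv]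
  congr 1
  ring

theorem tendsto_log_mul_rpow_div (c s : ℝ) :
    Tendsto (fun δ : ℝ≥0 =>
      (((Real.log c + s * Real.log (1 / (δ : ℝ))) / Real.log (1 / (δ : ℝ)) : ℝ) : EReal))
      (𝓝[>] (0 : ℝ≥0)) (𝓝 (s : EReal)) := by
  refine (continuous_coe_real_ereal.tendsto s).comp ?_
  have h := (tendsto_log_one_div_nhdsGT_zero.const_div_atTop (Real.log c)).add_const s
  rw [zero_add] at h
  refine h.congr' ?_
  filter_upwards [eventually_pos_log_one_div] with δ hδ
  have := hδ.2.ne'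
  field_simp

theorem le_lowerBoxDim {X : Type*} [PseudoEMetricSpace X] {A : Set X} {c s : ℝ} (hc : 0 < c)
    (h : ∀ᶠ δ : ℝ≥0 in 𝓝[>] (0 : ℝ≥0),
      ENNReal.ofReal (c * (δ : ℝ) ^ (-s)) ≤ (Metric.externalCoveringNumber δ A : ℝ≥0∞)) :
    (s : EReal) ≤ lowerBoxDim A := by
  rw [← (tendsto_log_mul_rpow_div c s).liminf_eq]
  refine liminf_le_liminf ?_
  filter_upwards [h, eventually_pos_log_one_div] with δ h1 h2
  rw [EReal.coe_div, ← log_mul_rpow_neg hc (NNReal.coe_pos.2 h2.1)]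
  exact EReal.div_le_div_right_of_nonneg (by exact_mod_cast h2.2.le) (ENNReal.log_le_log h1)

theorem upperBoxDim_le {X : Type*} [PseudoEMetricSpace X] {A : Set X} {c s : ℝ} (hc : 0 < c)
    (h : ∀ᶠ δ : ℝ≥0 in 𝓝[>] (0 : ℝ≥0),
      (Metric.externalCoveringNumber δ A : ℝ≥0∞) ≤ ENNReal.ofReal (c * (δ : ℝ) ^ (-s))) :
    upperBoxDim A ≤ (s : EReal) := by
  rw [← (tendsto_log_mul_rpow_div c s).limsup_eq]
  refine limsup_le_limsup ?_
  filter_upwards [h, eventually_pos_log_one_div] with δ h1 h2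
  rw [EReal.coe_div, ← log_mul_rpow_neg hc (NNReal.coe_pos.2 h2.1)]
  exact EReal.div_le_div_right_of_nonneg (by exact_mod_cast h2.2.le) (ENNReal.log_le_log h1)

theorem eventually_externalCoveringNumber_le {X : Type*} [PseudoEMetricSpace X] {A : Set X} {s : ℝ}
    (h : upperBoxDim A < (s : EReal)) : ∀ᶠ δ : ℝ≥0 in 𝓝[>] (0 : ℝ≥0),
      (Metric.externalCoveringNumber δ A : ℝ≥0∞) ≤ ENNReal.ofReal ((δ : ℝ) ^ (-s)) := by
  filter_upwards [eventually_lt_of_limsup_lt h, eventually_pos_log_one_div] with δ h1 h2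
  rw [boxRatio, EReal.div_lt_iff (by exact_mod_cast h2.2) (EReal.coe_ne_top _)] at h1
  have h3 := log_mul_rpow_neg (s := s) one_pos (NNReal.coe_pos.2 h2.1)
  rw [one_mul, Real.log_one, zero_add, EReal.coe_mul] at h3
  rw [← h3] at h1
  exact (ENNReal.log_lt_log_iff.1 h1).le

theorem lowerBoxDim_le_upperBoxDim {X : Type*} [PseudoEMetricSpace X] (A : Set X) :
    lowerBoxDim A ≤ upperBoxDim A :=
  liminf_le_limsup

theorem packingDim_le_upperBoxDim {X : Type*} [PseudoEMetricSpace X] (A : Set X) :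
    packingDim A ≤ upperBoxDim A :=
  (iInf₂_le (fun _ => A) (subset_iUnion (fun _ : ℕ => A) 0)).trans (iSup_le fun _ => le_rfl)

theorem externalCoveringNumber_biUnion_le {X ι : Type*} [PseudoEMetricSpace X] (δ : ℝ≥0)
    (E : ι → Set X) (t : Finset ι) :
    (Metric.externalCoveringNumber δ (⋃ i ∈ t, E i) : ℝ≥0∞) ≤
      ∑ i ∈ t, (Metric.externalCoveringNumber δ (E i) : ℝ≥0∞) := by
  classical
  have key (A B : Set X) : Metric.externalCoveringNumber δ (A ∪ B) ≤
      Metric.externalCoveringNumber δ A + Metric.externalCoveringNumber δ B := by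
    conv_rhs => simp only [Metric.externalCoveringNumber]
    simp only [ENat.iInf_add, ENat.add_iInf]
    refine le_iInf₂ fun C hC => le_iInf₂ fun D hD => ?_
    refine (Metric.IsCover.externalCoveringNumber_le_encard (C := D ∪ C) ?_).trans
      (encard_union_le _ _)
    rintro x (hx | hx)
    · obtain ⟨y, hy, h⟩ := hD hx
      exact ⟨y, Or.inl hy, h⟩
    · obtain ⟨y, hy, h⟩ := hC hx
      exact ⟨y, Or.inr hy, h⟩
  induction t using Finset.induction_on with
  | empty => simp
  | insert a t ha ih =>
    rw [Finset.sum_insert ha, Finset.set_biUnion_insert]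
    refine le_trans ?_ (add_le_add_right ih _)
    exact_mod_cast ENat.toENNReal_le.2 (key _ _)

theorem exists_finset_of_externalCoveringNumber {X : Type*} [PseudoEMetricSpace X] {δ : ℝ≥0}
    {A : Set X} (h : Metric.externalCoveringNumber δ A ≠ ⊤) :
    ∃ F : Finset X, (F.card : ℕ∞) = Metric.externalCoveringNumber δ A ∧
      Metric.IsCover δ A (F : Set X) := by
  have : Nonempty {C : Set X // Metric.IsCover δ A C} := ⟨⟨A, Metric.IsCover.rfl⟩⟩
  obtain ⟨C, hC⟩ := ENat.exists_eq_iInf (fun C : {C : Set X // Metric.IsCover δ A C} =>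
    (C : Set X).encard)
  have hC' : (C : Set X).encard = Metric.externalCoveringNumber δ A := by
    rw [hC, Metric.externalCoveringNumber, iInf_subtype]
  have hf : (C : Set X).Finite := by
    rw [← encard_ne_top_iff, hC']; exact h
  refine ⟨hf.toFinset, ?_, by simpa using C.2⟩
  rw [← hC', hf.encard_eq_coe_toFinset_card]

/-! ### Combinatorics: counting centers of almost-squares in a grid -/

/-- Sums of opposite corners of the almost-squares with corner coordinates in `X` and `Y`. -/
def cornerSums (X Y : Finset ℤ) : Set (ℤ × ℤ) :=
  {s | ∃ u ∈ X, ∃ v ∈ X, ∃ p ∈ Y, ∃ q ∈ Y, (q - p) - (v - u) ∈ Finset.Icc (-1 : ℤ) 1 ∧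
    s = (u + v, p + q)}

/-- Markov's inequality for fibers: the fibers are disjoint, so few of them can be large. It bounds
the number of rich diagonals. -/
theorem card_filter_fiber_le {ι κ : Type*} [DecidableEq κ] (P : Finset ι) (f : ι → κ) {K : ℝ}
    (hK : 0 < K) :
    (((P.image f).filter fun c => K < ((P.filter fun x => f x = c).card : ℝ)).card : ℝ) ≤
      P.card / K := by
  rw [le_div_iff₀ hK, ← nsmul_eq_mul]
  have h1 := Finset.card_eq_sum_card_image f P
  rw [h1, Nat.cast_sum]
  refine (Finset.card_nsmul_le_sum _ _ _ fun c hc => ?_).trans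
    (Finset.sum_le_sum_of_subset_of_nonneg (Finset.filter_subset _ _) fun _ _ _ => by positivity)
  exact (Finset.mem_filter.1 hc).2.le

/-- Diagonals with few points contribute few corner sums. -/
theorem card_sparse_pairs_le (P : Finset (ℤ × ℤ)) (f : ℤ × ℤ → ℤ) {K : ℝ} (hK : 0 ≤ K) :
    (((((P ×ˢ P) ×ˢ Finset.Icc (-1 : ℤ) 1).filter fun z =>
      f z.1.1 = f z.1.2 - z.2 ∧
        ((P.filter fun x => f x = f z.1.2 - z.2).card : ℝ) ≤ K).card : ℕ) : ℝ) ≤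
      3 * K * P.card := by
  classical
  set T := (((P ×ˢ P) ×ˢ Finset.Icc (-1 : ℤ) 1).filter fun z =>
      f z.1.1 = f z.1.2 - z.2 ∧ ((P.filter fun x => f x = f z.1.2 - z.2).card : ℝ) ≤ K)
  have hmaps : Set.MapsTo (fun z : ((ℤ × ℤ) × (ℤ × ℤ)) × ℤ => (z.1.2, z.2)) (T : Set _)
      ((P ×ˢ Finset.Icc (-1 : ℤ) 1 : Finset _) : Set _) := by
    intro z hz
    have := (Finset.mem_filter.1 (Finset.mem_coe.1 hz)).1
    simp only [Finset.mem_product] at this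
    simp only [Finset.coe_product, Set.mem_prod, Finset.mem_coe]
    exact ⟨this.1.2, this.2⟩
  rw [Finset.card_eq_sum_card_fiberwise hmaps, Nat.cast_sum]
  refine (Finset.sum_le_card_nsmul _ _ K ?_).trans (le_of_eq ?_)
  -- Once `y` and the error `e` are fixed, the diagonal containing `x` is known, and it has at most
  -- `K` points or is not counted at all.
  · rintro ⟨y, e⟩ -
    by_cases hy : ((P.filter fun x => f x = f y - e).card : ℝ) ≤ K
    · refine le_trans ?_ hy
      norm_cast
      refine Finset.card_le_card_of_injOn (fun z => z.1.1) ?_ ?_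
      · rintro ⟨⟨x, y'⟩, e'⟩ hz
        simp only [T, Finset.coe_filter, Set.mem_ofPred_eq, Finset.mem_filter, Finset.mem_product,
          Prod.mk.injEq] at hz ⊢
        obtain ⟨⟨⟨⟨h1, -⟩, -⟩, h2, -⟩, rfl, rfl⟩ := hz
        exact ⟨h1, h2⟩
      · rintro ⟨⟨x, y'⟩, e'⟩ hz ⟨⟨x2, y2⟩, e2⟩ hz2 h
        simp only [Finset.coe_filter, Set.mem_ofPred_eq, Prod.mk.injEq] at hz hz2 h ⊢
        grind
    · rw [Finset.card_eq_zero.2, Nat.cast_zero]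
      · exact hK
      · refine Finset.filter_eq_empty_iff.2 ?_
        rintro ⟨⟨x, y'⟩, e'⟩ hz h
        simp only [T, Finset.mem_filter, Prod.mk.injEq] at hz h
        obtain ⟨rfl, rfl⟩ := h
        exact hy hz.2.2
  · rw [Finset.card_product, nsmul_eq_mul]
    simp
    ring

/-- Either both diagonals through the corners are rich and their positions determine the sum, or one
is poor and the sum comes from two points of it. The error in `{-1, 0, 1}` costs a factor 3 in every
case. -/
theorem cornerSums_bound (X Y : Finset ℤ) {K : ℝ} (hK : 0 < K) :
    ∃ G : Finset (ℤ × ℤ), cornerSums X Y ⊆ G ∧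
      (G.card : ℝ) ≤ 3 * (X.card * Y.card / K) ^ 2 + 6 * K * (X.card * Y.card) := by
  classical
  set P := X ×ˢ Y
  have hP : (P.card : ℝ) = X.card * Y.card := by simp [P]
  let I := Finset.Icc (-1 : ℤ) 1
  let R (f : ℤ × ℤ → ℤ) := (P.image f).filter fun c => K < ((P.filter fun x => f x = c).card : ℝ)
  let T (f : ℤ × ℤ → ℤ) := ((P ×ˢ P) ×ˢ I).filter fun z => f z.1.1 = f z.1.2 - z.2 ∧
        ((P.filter fun x => f x = f z.1.2 - z.2).card : ℝ) ≤ K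
  let f : ℤ × ℤ → ℤ := fun z => z.2 - z.1
  let g : ℤ × ℤ → ℤ := fun z => z.2 + z.1
  refine ⟨((R f ×ˢ R g) ×ˢ I).image (fun z => (z.1.2 - z.1.1 - z.2, z.1.2 + z.1.1)) ∪
    ((T f).image (fun z => (z.1.1.1 + z.1.2.1, z.1.1.2 + z.1.2.2)) ∪
     (T g).image (fun z => (z.1.1.1 + z.1.2.1, z.1.1.2 + z.1.2.2))), ?_, ?_⟩
  · rintro _ ⟨u, hu, v, hv, p, hp, q, hq, he, rfl⟩
    have m (a b : ℤ) (ha : a ∈ X) (hb : b ∈ Y) : (a, b) ∈ P := Finset.mem_product.2 ⟨ha, hb⟩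
    by_cases h1 : K < ((P.filter fun x => f x = p - u).card : ℝ)
    · by_cases h2 : K < ((P.filter fun x => g x = q + u).card : ℝ)
      · simp only [Finset.coe_union, Finset.coe_image]
        -- The indices of the diagonal through `(u, p)` and of the antidiagonal through `(u, q)`,
        -- together with the side-length defect, recover `u + v` and `p + q`.
        refine Or.inl ⟨((p - u, q + u), (q - p) - (v - u)), ?_, ?_⟩
        · simp only [Finset.mem_coe, Finset.mem_product]
          exact ⟨⟨Finset.mem_filter.2 ⟨Finset.mem_image.2 ⟨(u, p), m _ _ hu hp, rfl⟩, h1⟩,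
            Finset.mem_filter.2 ⟨Finset.mem_image.2 ⟨(u, q), m _ _ hu hq, rfl⟩, h2⟩⟩, he⟩
        · ext <;> simp <;> ring
      · simp only [Finset.coe_union, Finset.coe_image]
        -- The antidiagonal is poor, so the other pair of opposite corners is used; it has the same
        -- sum.
        refine Or.inr (Or.inr ⟨(((u, q), (v, p)), (v - u) - (q - p)), ?_, ?_⟩)
        · simp only [T, g, Finset.mem_coe, Finset.mem_filter, Finset.mem_product]
          have e : p + v - (v - u - (q - p)) = q + u := by ring
          rw [e]
          refine ⟨⟨⟨⟨hu, hq⟩ |> Finset.mem_product.2, Finset.mem_product.2 ⟨hv, hp⟩⟩, ?_⟩, rfl, not_lt.1 h2⟩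
          simp only [I, Finset.mem_Icc] at he ⊢
          omega
        · ext
          · simp
          · simp [add_comm]
    · simp only [Finset.coe_union, Finset.coe_image]
      refine Or.inr (Or.inl ⟨(((u, p), (v, q)), (q - p) - (v - u)), ?_, ?_⟩)
      · simp only [T, f, Finset.mem_coe, Finset.mem_filter, Finset.mem_product]
        have e : q - v - (q - p - (v - u)) = p - u := by ring
        rw [e]
        exact ⟨⟨⟨m _ _ hu hp, m _ _ hv hq⟩, he⟩, rfl, not_lt.1 h1⟩
      · ext <;> simp
  · have hI : I.card = 3 := rfl
    have h1 : ((R f).card : ℝ) ≤ P.card / K := card_filter_fiber_le P f hK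
    have h2 : ((R g).card : ℝ) ≤ P.card / K := card_filter_fiber_le P g hK
    have h3 : ((T f).card : ℝ) ≤ 3 * K * P.card := card_sparse_pairs_le P f hK.le
    have h4 : ((T g).card : ℝ) ≤ 3 * K * P.card := card_sparse_pairs_le P g hK.le
    have h5 : (((R f ×ˢ R g) ×ˢ I).card : ℝ) ≤ 3 * (P.card / K) ^ 2 := by
      rw [Finset.card_product, Finset.card_product, hI]
      push_cast
      nlinarith [mul_le_mul h1 h2 (by positivity) (by positivity)]
    rw [← hP]
    refine le_trans (Nat.cast_le.2 ((Finset.card_union_le _ _).trans (add_le_add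
      Finset.card_image_le ((Finset.card_union_le _ _).trans
        (add_le_add Finset.card_image_le Finset.card_image_le))))) ?_
    push_cast at h5 ⊢
    linarith

/-! ### Rich lines at scale `δ` and the area of the set of centers -/

/-- The abscissas of the vertical lines that meet `E` in outer length at least `c`. -/
def richColumns (E : Set (ℝ × ℝ)) (c : ℝ) : Set ℝ :=
  {u | ENNReal.ofReal c ≤ volume {y : ℝ | (u, y) ∈ E}}

theorem abs_floor_sub_floor_le {a b : ℝ} (h : |a - b| ≤ 1) : |⌊a⌋ - ⌊b⌋| ≤ 1 := by
  rw [abs_le] at h ⊢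
  have h1 := Int.floor_le a
  have h2 := Int.lt_floor_add_one a
  have h3 := Int.floor_le b
  have h4 := Int.lt_floor_add_one b
  constructor
  · have : ((⌊b⌋ : ℤ) : ℝ) < ((⌊a⌋ + 2 : ℤ) : ℝ) := by push_cast; linarith [h.1]
    have := Int.cast_lt.1 this
    omega
  · have : ((⌊a⌋ : ℤ) : ℝ) < ((⌊b⌋ + 2 : ℤ) : ℝ) := by push_cast; linarith [h.2]
    have := Int.cast_lt.1 this
    omega

theorem abs_floor_div_sub_floor_div_le {a b δ : ℝ} (hδ : 0 < δ) (h : |a - b| ≤ δ) :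
    |⌊a / δ⌋ - ⌊b / δ⌋| ≤ 1 := by
  apply abs_floor_sub_floor_le
  rw [← sub_div, abs_div, abs_of_pos hδ]
  exact (div_le_one hδ).2 h

/-- Each nearby point of `F` accounts for at most length `2 * δ` on the vertical line. -/
theorem richColumn_card {E : Set (ℝ × ℝ)} {F : Finset (ℝ × ℝ)} {c δ u : ℝ} (hδ : 0 < δ)
    (hF : ∀ z ∈ E, ∃ p ∈ F, |z.1 - p.1| ≤ δ ∧ |z.2 - p.2| ≤ δ) (hu : u ∈ richColumns E c) :
    c ≤ 2 * δ * (F.filter fun p => |⌊u / δ⌋ - ⌊p.1 / δ⌋| ≤ 1).card := by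
  set F' := F.filter fun p => |⌊u / δ⌋ - ⌊p.1 / δ⌋| ≤ 1
  have h1 : {y : ℝ | (u, y) ∈ E} ⊆ ⋃ p ∈ F', Icc (p.2 - δ) (p.2 + δ) := by
    intro y hy
    obtain ⟨p, hp, h1, h2⟩ := hF _ hy
    refine mem_iUnion₂.2 ⟨p, Finset.mem_filter.2 ⟨hp, abs_floor_div_sub_floor_div_le hδ h1⟩, ?_⟩
    rw [abs_le] at h2
    exact ⟨by linarith [h2.1], by linarith [h2.2]⟩
  have h2 : volume {y : ℝ | (u, y) ∈ E} ≤ ENNReal.ofReal (2 * δ * F'.card) := by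
    refine (measure_mono h1).trans ((measure_biUnion_finset_le _ _).trans ?_)
    have e (p : ℝ × ℝ) : p.2 + δ - (p.2 - δ) = 2 * δ := by ring
    simp only [Real.volume_Icc, e, Finset.sum_const, nsmul_eq_mul]
    rw [mul_comm (2 * δ), ENNReal.ofReal_mul (p := (F'.card : ℝ)) (by positivity),
      ENNReal.ofReal_natCast]
  exact (ENNReal.ofReal_le_ofReal_iff (by positivity)).1 (le_trans hu h2)

/-- Double counting: each cell needs at least `c / (2 * δ)` nearby points, and each point is near
only three cells, whence the factor 6. -/
theorem exists_finset_floor_richColumns {E : Set (ℝ × ℝ)} {F : Finset (ℝ × ℝ)} {c δ : ℝ}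
    (hδ : 0 < δ) (hc : 0 < c) (hF : ∀ z ∈ E, ∃ p ∈ F, |z.1 - p.1| ≤ δ ∧ |z.2 - p.2| ≤ δ) :
    ∃ X : Finset ℤ, (∀ u ∈ richColumns E c, ⌊u / δ⌋ ∈ X) ∧ X.card * c ≤ 6 * δ * F.card := by
  classical
  let Z : Set ℤ := (fun u : ℝ => ⌊u / δ⌋) '' richColumns E c
  have hZ (k : ℤ) (hk : k ∈ Z) :
      c ≤ 2 * δ * (F.filter fun p => |k - ⌊p.1 / δ⌋| ≤ 1).card := by
    obtain ⟨u, hu, rfl⟩ := hk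
    exact richColumn_card hδ hF hu
  let W : Finset ℤ := F.biUnion fun p => Finset.Icc (⌊p.1 / δ⌋ - 1) (⌊p.1 / δ⌋ + 1)
  refine ⟨W.filter fun k => k ∈ Z, fun u hu => ?_, ?_⟩
  · refine Finset.mem_filter.2 ⟨?_, u, hu, rfl⟩
    have h := hZ _ ⟨u, hu, rfl⟩
    have hpos : 0 < (F.filter fun p => |⌊u / δ⌋ - ⌊p.1 / δ⌋| ≤ 1).card := by
      by_contra h0
      rw [Nat.eq_zero_of_not_pos h0] at h
      simp at h
      linarith
    obtain ⟨p, hp⟩ := Finset.card_pos.1 hpos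
    obtain ⟨hp, h2⟩ := Finset.mem_filter.1 hp
    rw [abs_le] at h2
    exact Finset.mem_biUnion.2 ⟨p, hp, Finset.mem_Icc.2 ⟨by omega, by omega⟩⟩
  · set X := W.filter fun k => k ∈ Z
    have h1 : (X.card : ℝ) * c ≤
        ∑ k ∈ X, 2 * δ * ((F.filter fun p => |k - ⌊p.1 / δ⌋| ≤ 1).card : ℝ) := by
      rw [← nsmul_eq_mul]
      exact Finset.card_nsmul_le_sum _ _ _ fun k hk => hZ k (Finset.mem_filter.1 hk).2
    have h2 : ∑ k ∈ X, (F.filter fun p => |k - ⌊p.1 / δ⌋| ≤ 1).card ≤ F.card * 3 := by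
      have := Finset.sum_card_bipartiteAbove_eq_sum_card_bipartiteBelow (s := X) (t := F)
        (fun k p => |k - ⌊p.1 / δ⌋| ≤ 1)
      simp only [Finset.bipartiteAbove, Finset.bipartiteBelow] at this
      rw [this, ← smul_eq_mul]
      refine Finset.sum_le_card_nsmul _ _ _ fun p _ => ?_
      have : (Finset.Icc (⌊p.1 / δ⌋ - 1) (⌊p.1 / δ⌋ + 1)).card = 3 := by
        rw [Int.card_Icc]; omega
      rw [← this]
      refine Finset.card_le_card fun k hk => ?_
      have := abs_le.1 (Finset.mem_filter.1 hk).2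
      exact Finset.mem_Icc.2 ⟨by omega, by omega⟩
    rw [← Finset.mul_sum] at h1
    have h3 : (∑ k ∈ X, ((F.filter fun p => |k - ⌊p.1 / δ⌋| ≤ 1).card : ℝ)) ≤ F.card * 3 := by
      exact_mod_cast h2
    calc (X.card : ℝ) * c ≤ _ := h1
      _ ≤ 2 * δ * (F.card * 3) := by gcongr
      _ = _ := by ring

theorem volume_le_card_cells {S : Set (ℝ × ℝ)} {G : Finset (ℤ × ℤ)} {δ : ℝ} (hδ : 0 < δ)
    (h : ∀ x ∈ S, (⌊x.1 / δ⌋, ⌊x.2 / δ⌋) ∈ G) :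
    volume S ≤ ENNReal.ofReal (G.card * δ ^ 2) := by
  have h1 : S ⊆ ⋃ g ∈ G, Ico (g.1 * δ) (g.1 * δ + δ) ×ˢ Ico (g.2 * δ) (g.2 * δ + δ) := by
    intro x hx
    refine mem_iUnion₂.2 ⟨_, h x hx, ?_⟩
    have key (a : ℝ) : a ∈ Ico (⌊a / δ⌋ * δ) (⌊a / δ⌋ * δ + δ) := by
      constructor
      · exact (le_div_iff₀ hδ).1 (Int.floor_le _)
      · have := (div_lt_iff₀ hδ).1 (Int.lt_floor_add_one (a / δ))
        linarith
    exact ⟨key _, key _⟩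
  refine (measure_mono h1).trans ((measure_biUnion_finset_le _ _).trans ?_)
  simp only [Measure.volume_eq_prod, Measure.prod_prod, Real.volume_Ico, add_sub_cancel_left,
    Finset.sum_const, nsmul_eq_mul]
  rw [ENNReal.ofReal_mul (by positivity), ENNReal.ofReal_natCast, sq,
    ENNReal.ofReal_mul hδ.le]

theorem floor_eq_half_add {a b δ : ℝ} :
    ∃ e ∈ Finset.Icc (0 : ℤ) 1, ⌊(a + b) / 2 / δ⌋ = (⌊a / δ⌋ + ⌊b / δ⌋) / 2 + e := by
  refine ⟨⌊(a + b) / 2 / δ⌋ - (⌊a / δ⌋ + ⌊b / δ⌋) / 2, ?_, by ring⟩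
  have e : (a + b) / 2 / δ = (a / δ + b / δ) / 2 := by ring
  rw [e]
  have h1 := Int.floor_le (a / δ)
  have h2 := Int.lt_floor_add_one (a / δ)
  have h3 := Int.floor_le (b / δ)
  have h4 := Int.lt_floor_add_one (b / δ)
  have h5 := Int.floor_le ((a / δ + b / δ) / 2)
  have h6 := Int.lt_floor_add_one ((a / δ + b / δ) / 2)
  set k := ⌊(a / δ + b / δ) / 2⌋
  have h7 : ((⌊a / δ⌋ + ⌊b / δ⌋ : ℤ) : ℝ) < ((2 * k + 2 : ℤ) : ℝ) := by push_cast; linarith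
  have h8 : ((2 * k : ℤ) : ℝ) < ((⌊a / δ⌋ + ⌊b / δ⌋ + 2 : ℤ) : ℝ) := by push_cast; linarith
  have h7 := Int.cast_lt.1 h7
  have h8 := Int.cast_lt.1 h8
  rw [Finset.mem_Icc]
  omega

theorem floor_sub_floor_mem {a b c d δ : ℝ} (h : b - a = d - c) :
    (⌊d / δ⌋ - ⌊c / δ⌋) - (⌊b / δ⌋ - ⌊a / δ⌋) ∈ Finset.Icc (-1 : ℤ) 1 := by
  have e : b / δ - a / δ = d / δ - c / δ := by rw [← sub_div, h, sub_div]
  have h1 := Int.floor_le (a / δ)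
  have h2 := Int.lt_floor_add_one (a / δ)
  have h3 := Int.floor_le (b / δ)
  have h4 := Int.lt_floor_add_one (b / δ)
  have h5 := Int.floor_le (c / δ)
  have h6 := Int.lt_floor_add_one (c / δ)
  have h7 := Int.floor_le (d / δ)
  have h8 := Int.lt_floor_add_one (d / δ)
  set z := (⌊d / δ⌋ - ⌊c / δ⌋) - (⌊b / δ⌋ - ⌊a / δ⌋) with hz
  have hz' : (z : ℝ) = (⌊d / δ⌋ - ⌊c / δ⌋) - (⌊b / δ⌋ - ⌊a / δ⌋) := by rw [hz]; push_cast; ring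
  have h9 : ((-2 : ℤ) : ℝ) < (z : ℝ) := by rw [hz']; push_cast; linarith
  have h10 : (z : ℝ) < ((2 : ℤ) : ℝ) := by rw [hz']; push_cast; linarith
  have h9 := Int.cast_lt.1 h9
  have h10 := Int.cast_lt.1 h10
  rw [Finset.mem_Icc]
  omega

/-- `x` is the center of a square whose sides lie on lines that meet `E` in length at least `c`. -/
def IsRichCenter (E : Set (ℝ × ℝ)) (c : ℝ) (r : ℝ) (x : ℝ × ℝ) : Prop :=
  x.1 - r ∈ richColumns E c ∧ x.1 + r ∈ richColumns E c ∧
    x.2 - r ∈ richColumns (Prod.swap ⁻¹' E) c ∧ x.2 + r ∈ richColumns (Prod.swap ⁻¹' E) c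

/-- Rounding turns the true squares into almost-squares with corners in `X` and `Y`, so
`cornerSums_bound` counts the cells of the centers. -/
theorem volume_centers_le {E S : Set (ℝ × ℝ)} {F : Finset (ℝ × ℝ)} {c δ : ℝ}
    (hδ : 0 < δ) (hc : 0 < c) (hF : ∀ z ∈ E, ∃ p ∈ F, |z.1 - p.1| ≤ δ ∧ |z.2 - p.2| ≤ δ)
    (hS : ∀ x ∈ S, ∃ r, IsRichCenter E c r x) :
    volume S ≤ ENNReal.ofReal (36 * (6 * δ * F.card / c) ^ (8 / 3 : ℝ) * δ ^ 2) := by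
  classical
  obtain ⟨X, hX, hXc⟩ := exists_finset_floor_richColumns hδ hc hF
  obtain ⟨Y, hY, hYc⟩ := exists_finset_floor_richColumns (E := Prod.swap ⁻¹' E)
    (F := F.image Prod.swap) hδ hc (fun z hz => by
      obtain ⟨p, hp, h1, h2⟩ := hF _ hz
      exact ⟨p.swap, Finset.mem_image_of_mem _ hp, h2, h1⟩)
  rw [Finset.card_image_of_injective _ Prod.swap_injective] at hYc
  -- The threshold `K` below must be positive, so `F` empty is treated apart.
  rcases F.eq_empty_or_nonempty with rfl | hne
  · have : S = ∅ := by
      refine eq_empty_of_forall_notMem fun x hx => ?_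
      obtain ⟨r, hr, -⟩ := hS x hx
      have h1 := hX _ hr
      have h2 : 0 < (X.card : ℝ) := by exact_mod_cast Finset.card_pos.2 ⟨_, h1⟩
      simp at hXc
      nlinarith
    simp [this]
  set m := 6 * δ * F.card / c
  have hm : 0 < m := by
    have : 0 < (F.card : ℝ) := by exact_mod_cast Finset.card_pos.2 hne
    positivity
  have hXm : (X.card : ℝ) ≤ m := (le_div_iff₀ hc).2 hXc
  have hYm : (Y.card : ℝ) ≤ m := (le_div_iff₀ hc).2 hYc
  -- This `K` balances `(m ^ 2 / K) ^ 2` against `K * m ^ 2`.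
  obtain ⟨G, hG, hGc⟩ := cornerSums_bound X Y (K := m ^ (2 / 3 : ℝ)) (Real.rpow_pos_of_pos hm _)
  have hGm : (G.card : ℝ) ≤ 9 * m ^ (8 / 3 : ℝ) := by
    have hXY : (X.card : ℝ) * Y.card ≤ m * m := by gcongr
    have hK := Real.rpow_pos_of_pos hm (2 / 3 : ℝ)
    have e1 : m * m = m ^ (2 : ℝ) := by norm_num [sq]
    have e2 : (m * m / m ^ (2 / 3 : ℝ)) ^ 2 = m ^ (8 / 3 : ℝ) := by
      rw [e1, ← Real.rpow_sub hm, ← Real.rpow_natCast, ← Real.rpow_mul hm.le]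
      norm_num
    have e3 : m ^ (2 / 3 : ℝ) * (m * m) = m ^ (8 / 3 : ℝ) := by
      rw [e1, ← Real.rpow_add hm]; norm_num
    calc (G.card : ℝ) ≤ _ := hGc
      _ ≤ 3 * (m * m / m ^ (2 / 3 : ℝ)) ^ 2 + 6 * m ^ (2 / 3 : ℝ) * (m * m) := by gcongr
      _ = 9 * m ^ (8 / 3 : ℝ) := by rw [e2, mul_assoc 6, e3]; ring
  let I := Finset.Icc (0 : ℤ) 1
  -- Halving a corner sum leaves an error 0 or 1 in each coordinate: four cells per sum.
  refine (volume_le_card_cells (G := (G ×ˢ (I ×ˢ I)).image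
    fun z => (z.1.1 / 2 + z.2.1, z.1.2 / 2 + z.2.2)) hδ fun x hx => ?_).trans
      (ENNReal.ofReal_le_ofReal ?_)
  · obtain ⟨r, h1, h2, h3, h4⟩ := hS x hx
    have hmem : (⌊(x.1 - r) / δ⌋ + ⌊(x.1 + r) / δ⌋, ⌊(x.2 - r) / δ⌋ + ⌊(x.2 + r) / δ⌋) ∈ G :=
      hG ⟨_, hX _ h1, _, hX _ h2, _, hY _ h3, _, hY _ h4, floor_sub_floor_mem (by ring), rfl⟩
    obtain ⟨e, he, he'⟩ := floor_eq_half_add (a := x.1 - r) (b := x.1 + r) (δ := δ)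
    obtain ⟨f, hf, hf'⟩ := floor_eq_half_add (a := x.2 - r) (b := x.2 + r) (δ := δ)
    rw [show (x.1 - r + (x.1 + r)) / 2 = x.1 by ring] at he'
    rw [show (x.2 - r + (x.2 + r)) / 2 = x.2 by ring] at hf'
    rw [he', hf']
    exact Finset.mem_image.2 ⟨(_, (e, f)), Finset.mem_product.2 ⟨hmem, Finset.mem_product.2 ⟨he, hf⟩⟩, rfl⟩
  · have h4 : ((((G ×ˢ (I ×ˢ I)).image
        fun z => (z.1.1 / 2 + z.2.1, z.1.2 / 2 + z.2.2)).card : ℕ) : ℝ) ≤ G.card * 4 := by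
      have := Finset.card_image_le (s := G ×ˢ (I ×ˢ I))
        (f := fun z => (z.1.1 / 2 + z.2.1, z.1.2 / 2 + z.2.2))
      rw [Finset.card_product] at this
      exact_mod_cast this
    have : 0 ≤ δ ^ 2 := by positivity
    nlinarith

/-- A planar set in coordinates. -/
def coordSet (E : Set Plane) : Set (ℝ × ℝ) := {z | (!₂[z.1, z.2] : Plane) ∈ E}

/-- This solves the area bound of `volume_centers_le` for the number of discs. The constant depends
on the outer area of `S` and on `c`, but not on `δ`. -/
theorem externalCoveringNumber_ge {E : Set Plane} {S : Set (ℝ × ℝ)} {c : ℝ} (hc : 0 < c)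
    (hS0 : volume S ≠ 0) (hS : ∀ x ∈ S, ∃ r, IsRichCenter (coordSet E) c r x) :
    ∃ c₀ : ℝ, 0 < c₀ ∧ ∀ δ : ℝ≥0, 0 < δ →
      ENNReal.ofReal (c₀ * (δ : ℝ) ^ (-(7 / 4) : ℝ)) ≤
        (Metric.externalCoveringNumber δ E : ℝ≥0∞) := by
  classical
  -- A finite positive stand-in for the outer area of `S`, which may be infinite.
  obtain ⟨a, -, ha, haS⟩ := ENNReal.lt_iff_exists_real_btwn.1 (pos_iff_ne_zero.2 hS0)
  rw [ENNReal.ofReal_pos] at ha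
  refine ⟨(a / 36) ^ (3 / 8 : ℝ) * (c / 6), by positivity, fun δ hδ' => ?_⟩
  have hδ : 0 < (δ : ℝ) := NNReal.coe_pos.2 hδ'
  by_cases htop : Metric.externalCoveringNumber δ E = ⊤
  · simp [htop]
  obtain ⟨F, hFc, hF⟩ := exists_finset_of_externalCoveringNumber htop
  have hle := volume_centers_le (E := coordSet E) (S := S) (c := c)
    (F := F.image fun q : Plane => (q 0, q 1)) hδ hc (fun z hz => by
      obtain ⟨q, hq, h⟩ := hF hz
      have hd : dist (!₂[z.1, z.2] : Plane) q ≤ δ := by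
        have h : edist (!₂[z.1, z.2] : Plane) q ≤ δ := h
        rw [edist_nndist] at h
        exact_mod_cast h
      rw [dist_eq_norm] at hd
      refine ⟨_, Finset.mem_image_of_mem _ hq, ?_, ?_⟩
      · simpa using (PiLp.norm_apply_le (!₂[z.1, z.2] - q : Plane) 0).trans hd
      · simpa using (PiLp.norm_apply_le (!₂[z.1, z.2] - q : Plane) 1).trans hd) hS
  have hcard : ((F.image fun q : Plane => (q 0, q 1)).card : ℝ) ≤ F.card := by
    exact_mod_cast Finset.card_image_le
  have h1 : a ≤ 36 * (6 * δ * F.card / c) ^ (8 / 3 : ℝ) * (δ : ℝ) ^ 2 := by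
    refine (ENNReal.ofReal_le_ofReal_iff (by positivity)).1 ((haS.le.trans hle).trans ?_)
    refine ENNReal.ofReal_le_ofReal ?_
    gcongr
  have h2 : a / 36 * (δ : ℝ) ^ (-2 : ℝ) ≤ (6 * δ * F.card / c) ^ (8 / 3 : ℝ) := by
    rw [Real.rpow_neg hδ.le, Real.rpow_two, ← div_eq_mul_inv, div_le_iff₀ (by positivity)]
    linarith
  have h3 := Real.rpow_le_rpow (by positivity) h2 (by norm_num : (0 : ℝ) ≤ 3 / 8)
  rw [← Real.rpow_mul (by positivity), Real.mul_rpow (by positivity) (by positivity),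
    ← Real.rpow_mul hδ.le] at h3
  norm_num at h3
  rw [← hFc]
  have h4 : (a / 36) ^ (3 / 8 : ℝ) * (c / 6) * (δ : ℝ) ^ (-(7 / 4) : ℝ) ≤ F.card := by
    have e : (δ : ℝ) ^ (-(7 / 4) : ℝ) = (δ : ℝ) ^ (-(3 / 4) : ℝ) / δ := by
      rw [show (-(7 / 4) : ℝ) = -(3 / 4) - 1 by norm_num, Real.rpow_sub hδ, Real.rpow_one]
    rw [le_div_iff₀ hc] at h3
    rw [e, mul_div_assoc', div_le_iff₀ hδ]
    linarith
  calc ENNReal.ofReal _ ≤ ENNReal.ofReal (F.card : ℝ) := ENNReal.ofReal_le_ofReal h4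
    _ = _ := by simp

/-! ### Lower bounds for sets that contain square boundaries -/

theorem mem_unitSquareBoundary {p : Plane} :
    p ∈ unitSquareBoundary ↔ (∀ i, p i ∈ Icc (-1 : ℝ) 1) ∧ ∃ i, p i = -1 ∨ p i = 1 := by
  have e : {p : Plane | ∀ i, p i ∈ Icc (-1 : ℝ) 1} =
      (EuclideanSpace.equiv (Fin 2) ℝ).toHomeomorph ⁻¹' (univ.pi fun _ => Icc (-1 : ℝ) 1) := by
    ext p
    simp only [Set.mem_preimage, Set.mem_univ_pi]
    rfl
  have hc : IsClosed {p : Plane | ∀ i, p i ∈ Icc (-1 : ℝ) 1} := by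
    rw [e]
    exact (isClosed_set_pi fun _ _ => isClosed_Icc).preimage (Homeomorph.continuous _)
  have hi : interior {p : Plane | ∀ i, p i ∈ Icc (-1 : ℝ) 1} =
      {p : Plane | ∀ i, p i ∈ Ioo (-1 : ℝ) 1} := by
    rw [e, ← Homeomorph.preimage_interior, interior_pi_set finite_univ]
    ext p
    simp only [Set.mem_preimage, Set.mem_univ_pi, interior_Icc]
    rfl
  rw [unitSquareBoundary, hc.frontier_eq, hi]
  constructor
  · rintro ⟨h1, h2⟩
    refine ⟨h1, ?_⟩
    by_contra! h
    exact h2 fun i => ⟨lt_of_le_of_ne (h1 i).1 (h i).1.symm, lt_of_le_of_ne (h1 i).2 (h i).2⟩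
  · rintro ⟨h1, i, h2⟩
    refine ⟨h1, fun h => ?_⟩
    have := h i
    rcases h2 with h2 | h2 <;> rw [h2] at this <;> simp at this

theorem mem_of_square_subset {B : Set Plane} {x : Plane} {r : ℝ} (hr : 0 < r)
    (h : (fun t : Plane => x + r • t) '' unitSquareBoundary ⊆ B) {p : Plane}
    (hp : ∀ i, p i ∈ Icc (x i - r) (x i + r)) (hp' : ∃ i, p i = x i - r ∨ p i = x i + r) :
    p ∈ B := by
  refine h ⟨r⁻¹ • (p - x), mem_unitSquareBoundary.2 ⟨fun i => ?_, ?_⟩, ?_⟩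
  · have := hp i
    simp only [PiLp.smul_apply, PiLp.sub_apply, smul_eq_mul]
    rw [← div_eq_inv_mul, mem_Icc, le_div_iff₀ hr, div_le_iff₀ hr]
    exact ⟨by linarith [this.1], by linarith [this.2]⟩
  · obtain ⟨i, hi⟩ := hp'
    refine ⟨i, ?_⟩
    simp only [PiLp.smul_apply, PiLp.sub_apply, smul_eq_mul]
    rcases hi with hi | hi
    · left; rw [hi]; field_simp; ring
    · right; rw [hi]; field_simp; ring
  · simp [smul_smul, mul_inv_cancel₀ hr.ne']

/-- The outer lengths of the slices increase to a positive limit, while the threshold tends to 0.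
Continuity from below holds for outer measure, so no measurability is needed. -/
theorem eventually_mem_richColumns {E : ℕ → Set (ℝ × ℝ)} (hE : Monotone E) {u a r : ℝ} (hr : 0 < r)
    (h : ∀ y ∈ Icc (a - r) (a + r), (u, y) ∈ ⋃ k, E k) :
    ∀ᶠ k : ℕ in atTop, u ∈ richColumns (E k) (1 / ((k : ℝ) + 1)) := by
  have hmono : Monotone fun k => {y : ℝ | (u, y) ∈ E k} := fun i j hij y hy => hE hij hy
  have h1 := tendsto_measure_iUnion_atTop (μ := volume) hmono
  have h2 : 0 < volume (⋃ k, {y : ℝ | (u, y) ∈ E k}) := by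
    refine lt_of_lt_of_le ?_ (measure_mono (s := Icc (a - r) (a + r)) fun y hy => ?_)
    · rw [Real.volume_Icc, ENNReal.ofReal_pos]; linarith
    · obtain ⟨k, hk⟩ := mem_iUnion.1 (h y hy)
      exact mem_iUnion.2 ⟨k, hk⟩
  have h3 : Tendsto (fun k : ℕ => ENNReal.ofReal (1 / ((k : ℝ) + 1))) atTop (𝓝 0) := by
    have := ENNReal.tendsto_ofReal tendsto_one_div_add_atTop_nhds_zero_nat
    rwa [ENNReal.ofReal_zero] at this
  filter_upwards [h3.eventually_lt h1 h2] with k hk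
  exact hk.le

/-- Every center in the unit square is eventually a rich center for `E k`, so one of the countably
many sets of rich centers has positive outer area. A constant sequence serves the box dimension,
finite unions of a cover the packing dimension. -/
theorem exists_externalCoveringNumber_ge {B : Set Plane} (hB : ContainsSquareBoundaries B unitSquare)
    {E : ℕ → Set Plane} (hE : Monotone E) (hBE : B ⊆ ⋃ k, E k) :
    ∃ k, ∃ c₀ : ℝ, 0 < c₀ ∧ ∀ δ : ℝ≥0, 0 < δ →
      ENNReal.ofReal (c₀ * (δ : ℝ) ^ (-(7 / 4) : ℝ)) ≤
        (Metric.externalCoveringNumber δ (E k) : ℝ≥0∞) := by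
  let S (k : ℕ) : Set (ℝ × ℝ) :=
    {x | ∃ r, IsRichCenter (coordSet (E k)) (1 / ((k : ℝ) + 1)) r x}
  have hcover : Icc (0 : ℝ) 1 ×ˢ Icc (0 : ℝ) 1 ⊆ ⋃ k, S k := by
    rintro ⟨a, b⟩ ⟨ha, hb⟩
    obtain ⟨r, hr, hsub⟩ := hB (!₂[a, b]) (by
      intro i
      fin_cases i
      · exact ha
      · exact hb)
    have hM : Monotone fun k => coordSet (E k) := fun i j hij z hz => hE hij hz
    have hM' : Monotone fun k => Prod.swap ⁻¹' coordSet (E k) := fun i j hij z hz => hE hij hz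
    have key (z : ℝ × ℝ) (h1 : z.1 ∈ Icc (a - r) (a + r)) (h2 : z.2 ∈ Icc (b - r) (b + r))
        (h3 : (z.1 = a - r ∨ z.1 = a + r) ∨ (z.2 = b - r ∨ z.2 = b + r)) :
        z ∈ ⋃ k, coordSet (E k) := by
      have : (!₂[z.1, z.2] : Plane) ∈ ⋃ k, E k := by
        refine hBE (mem_of_square_subset hr hsub ?_ ?_)
        · intro i
          fin_cases i
          · exact h1
          · exact h2
        · rcases h3 with h3 | h3
          · exact ⟨0, h3⟩
          · exact ⟨1, h3⟩
      obtain ⟨k, hk⟩ := mem_iUnion.1 this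
      exact mem_iUnion.2 ⟨k, hk⟩
    have key' (z : ℝ × ℝ) (hz : z.swap ∈ ⋃ k, coordSet (E k)) :
        z ∈ ⋃ k, Prod.swap ⁻¹' coordSet (E k) := by
      rw [← preimage_iUnion]; exact hz
    have e1 := eventually_mem_richColumns hM (u := a - r) (a := b) hr fun y hy =>
      key (a - r, y) ⟨le_rfl, by linarith⟩ hy (Or.inl (Or.inl rfl))
    have e2 := eventually_mem_richColumns hM (u := a + r) (a := b) hr fun y hy =>
      key (a + r, y) ⟨by linarith, le_rfl⟩ hy (Or.inl (Or.inr rfl))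
    have e3 := eventually_mem_richColumns hM' (u := b - r) (a := a) hr fun y hy =>
      key' _ (key (y, b - r) hy ⟨le_rfl, by linarith⟩ (Or.inr (Or.inl rfl)))
    have e4 := eventually_mem_richColumns hM' (u := b + r) (a := a) hr fun y hy =>
      key' _ (key (y, b + r) hy ⟨by linarith, le_rfl⟩ (Or.inr (Or.inr rfl)))
    obtain ⟨k, h1, h2, h3, h4⟩ := (e1.and (e2.and (e3.and e4))).exists
    exact mem_iUnion.2 ⟨k, r, h1, h2, h3, h4⟩
  have hpos : volume (⋃ k, S k) ≠ 0 := by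
    refine (lt_of_lt_of_le ?_ (measure_mono hcover)).ne'
    rw [Measure.volume_eq_prod, Measure.prod_prod, Real.volume_Icc]
    simp
  obtain ⟨k, hk⟩ := exists_measure_pos_of_not_measure_iUnion_null hpos
  obtain ⟨c₀, h0, h⟩ := externalCoveringNumber_ge (E := E k) (S := S k)
    (c := 1 / ((k : ℝ) + 1)) (by positivity) hk.ne' fun x hx => hx
  exact ⟨k, c₀, h0, h⟩

theorem le_lowerBoxDim_of_containsSquareBoundaries {B : Set Plane}
    (hB : ContainsSquareBoundaries B unitSquare) : ((7 / 4 : ℝ) : EReal) ≤ lowerBoxDim B := by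
  obtain ⟨k, c₀, h0, h⟩ := exists_externalCoveringNumber_ge hB (E := fun _ => B) monotone_const
    (subset_iUnion (fun _ : ℕ => B) 0)
  refine le_lowerBoxDim h0 ?_
  filter_upwards [self_mem_nhdsWithin] with δ hδ using h δ hδ

theorem le_packingDim_of_containsSquareBoundaries {B : Set Plane}
    (hB : ContainsSquareBoundaries B unitSquare) : ((7 / 4 : ℝ) : EReal) ≤ packingDim B := by
  refine le_iInf₂ fun E hE => ?_
  by_contra! hlt
  obtain ⟨s, hs1, hs2⟩ := EReal.lt_iff_exists_real_btwn.1 hlt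
  obtain ⟨k, c₀, h0, h⟩ := exists_externalCoveringNumber_ge hB
    (E := fun k => ⋃ i ∈ Finset.range (k + 1), E i)
    (fun i j hij => biUnion_subset_biUnion_left fun x hx => by
      simp only [SetLike.mem_coe, Finset.mem_range] at hx ⊢
      omega)
    (hE.trans (iUnion_subset fun i => subset_iUnion_of_subset i
      (subset_biUnion_of_mem (u := E) (x := i) (by simp))))
  have h1 : ∀ᶠ δ : ℝ≥0 in 𝓝[>] (0 : ℝ≥0), ∀ i ∈ Finset.range (k + 1),
      (Metric.externalCoveringNumber δ (E i) : ℝ≥0∞) ≤ ENNReal.ofReal ((δ : ℝ) ^ (-s)) := by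
    rw [Filter.eventually_all_finset]
    exact fun i _ => eventually_externalCoveringNumber_le
      ((le_iSup (fun i => upperBoxDim (E i)) i).trans_lt hs1)
  -- Upper box dimension is stable under finite unions: `k + 1` pieces only change the constant.
  have h2 : upperBoxDim (⋃ i ∈ Finset.range (k + 1), E i) ≤ (s : EReal) := by
    refine upperBoxDim_le (c := (k : ℝ) + 1) (by positivity) ?_
    filter_upwards [h1] with δ hδ
    refine (externalCoveringNumber_biUnion_le _ _ _).trans
      ((Finset.sum_le_card_nsmul _ _ _ hδ).trans (le_of_eq ?_))
    rw [ENNReal.ofReal_mul (by positivity), nsmul_eq_mul, Finset.card_range,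
      ← ENNReal.ofReal_natCast]
    push_cast
    rfl
  have h3 : ((7 / 4 : ℝ) : EReal) ≤ lowerBoxDim (⋃ i ∈ Finset.range (k + 1), E i) := by
    refine le_lowerBoxDim h0 ?_
    filter_upwards [self_mem_nhdsWithin] with δ hδ using h δ hδ
  exact absurd ((h3.trans (lowerBoxDim_le_upperBoxDim _)).trans h2) (not_le.2 hs2)

/-! ### Choosing the radius by its binary digits -/

/-- The numbers in `[-3, 4]` whose binary digits at the places `4 k + i` after the point vanish. -/
def digitSet (i : ℕ) : Set ℝ :=
  {x | x ∈ Icc (-3 : ℝ) 4 ∧ ∀ k : ℕ, Even ⌊(2 : ℝ) ^ (4 * k + i) * x⌋}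

/-- The bits of `r` are chosen from the lowest up. Adding `2 ^ M` to `r` flips bit `M` of `s M * r +
a M` and leaves the earlier conditions intact, since it changes those quotients by even numbers. -/
theorem exists_int_even_ediv (s a : ℕ → ℤ) (hs : ∀ j, s j = 1 ∨ s j = -1) (M : ℕ) :
    ∃ r : ℤ, 0 ≤ r ∧ r < 2 ^ M ∧ ∀ j < M, Even ((s j * r + a j) / 2 ^ j) := by
  induction M with
  | zero => exact ⟨0, le_rfl, by simp, by simp⟩
  | succ M ih =>
    obtain ⟨r, h0, h1, h2⟩ := ih
    have hpow : (2 : ℤ) ^ (M + 1) = 2 ^ M + 2 ^ M := by ring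
    by_cases hM : Even ((s M * r + a M) / 2 ^ M)
    · refine ⟨r, h0, by have := pow_pos (two_pos (α := ℤ)) M; omega, fun j hj => ?_⟩
      rcases Nat.lt_succ_iff_lt_or_eq.1 hj with h | rfl
      · exact h2 j h
      · exact hM
    · refine ⟨r + 2 ^ M, by positivity, by omega, fun j hj => ?_⟩
      rcases Nat.lt_succ_iff_lt_or_eq.1 hj with h | rfl
      · have e : s j * (r + 2 ^ M) + a j = (s j * r + a j) + s j * 2 ^ (M - j) * 2 ^ j := by
          rw [mul_assoc, ← pow_add, Nat.sub_add_cancel h.le]; ring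
        rw [e, Int.add_mul_ediv_right _ _ (by positivity)]
        refine (h2 j h).add (Even.mul_left ?_ _)
        exact (even_two).pow_of_ne_zero (by omega)
      · have e : s j * (r + 2 ^ j) + a j = (s j * r + a j) + s j * 2 ^ j := by ring
        rw [e, Int.add_mul_ediv_right _ _ (by positivity)]
        refine (Int.not_even_iff_odd.1 hM).add_odd ?_
        rcases hs j with h | h <;> rw [h] <;> decide

theorem floor_intCast_div_two_pow (y : ℤ) (j : ℕ) : ⌊(y : ℝ) / 2 ^ j⌋ = y / 2 ^ j := by
  have := Int.floor_div_natCast (y : ℝ) (2 ^ j)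
  simpa using this

/-- The place `4 * k + i` after the point is bit `j = 4 * N - (4 * k + i)` of `y`, hence the
condition on `j % 4`; later places vanish automatically. -/
theorem intCast_div_mem_digitSet {i N : ℕ} {y : ℤ} (h1 : 1 ≤ i) (h4 : i ≤ 4)
    (hy : (y : ℝ) / 16 ^ N ∈ Icc (-3 : ℝ) 4)
    (h : ∀ j < 4 * N, 4 - j % 4 = i → Even (y / 2 ^ j)) : (y : ℝ) / 16 ^ N ∈ digitSet i := by
  refine ⟨hy, fun k => ?_⟩
  have e16 : (16 : ℝ) ^ N = 2 ^ (4 * N) := by rw [pow_mul]; norm_num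
  rw [e16]
  by_cases hk : 4 * k + i ≤ 4 * N
  · have e : (2 : ℝ) ^ (4 * k + i) * (y / 2 ^ (4 * N)) = y / 2 ^ (4 * N - (4 * k + i)) := by
      rw [pow_sub₀ _ two_ne_zero hk]
      field_simp
    rw [e, floor_intCast_div_two_pow]
    exact h _ (by omega) (by omega)
  · have e : (2 : ℝ) ^ (4 * k + i) * (y / 2 ^ (4 * N)) =
        ((2 ^ (4 * k + i - 4 * N) * y : ℤ) : ℝ) := by
      push_cast
      rw [pow_sub₀ _ two_ne_zero (by omega)]
      field_simp
    rw [e, Int.floor_intCast]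
    exact Even.mul_right (even_two.pow_of_ne_zero (by omega)) _

/-- Each residue of `j` modulo 4 is assigned to one of the four sides, so the conditions never
compete for a bit of `r`. The radius is `1 + r / 16 ^ N`; the added 1 keeps it away from 0. -/
theorem exists_dyadic_digitSet (A B : ℤ) (N : ℕ) (hA : (A : ℝ) / 16 ^ N ∈ Icc (0 : ℝ) 1)
    (hB : (B : ℝ) / 16 ^ N ∈ Icc (0 : ℝ) 1) :
    ∃ R ∈ Icc (1 : ℝ) 2, (A : ℝ) / 16 ^ N - R ∈ digitSet 1 ∧ (A : ℝ) / 16 ^ N + R ∈ digitSet 2 ∧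
      (B : ℝ) / 16 ^ N - R ∈ digitSet 3 ∧ (B : ℝ) / 16 ^ N + R ∈ digitSet 4 := by
  let s : ℕ → ℤ := fun j => if j % 4 = 3 then -1 else if j % 4 = 2 then 1 else
    if j % 4 = 1 then -1 else 1
  let a : ℕ → ℤ := fun j => if j % 4 = 3 then A - 16 ^ N else if j % 4 = 2 then A + 16 ^ N else
    if j % 4 = 1 then B - 16 ^ N else B + 16 ^ N
  obtain ⟨r, h0, h1, h2⟩ := exists_int_even_ediv s a (by intro j; simp only [s]; split_ifs <;> simp)
    (4 * N)
  have hp : (0 : ℝ) < 16 ^ N := by positivity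
  have h0' : (0 : ℝ) ≤ r := by exact_mod_cast h0
  have h1' : (r : ℝ) < 16 ^ N := by
    have : (r : ℝ) < 2 ^ (4 * N) := by exact_mod_cast h1
    rw [pow_mul] at this
    norm_num at this
    exact this
  have hR : (r : ℝ) / 16 ^ N + 1 ∈ Icc (1 : ℝ) 2 := by
    have h3 := div_nonneg h0' hp.le
    have h4 := (div_lt_one hp).2 h1'
    exact ⟨by linarith, by linarith⟩
  have em (C : ℤ) : (C : ℝ) / 16 ^ N - (r / 16 ^ N + 1) = ((-1 * r + (C - 16 ^ N) : ℤ) : ℝ) / 16 ^ N := by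
    push_cast; field_simp; ring
  have ep (C : ℤ) : (C : ℝ) / 16 ^ N + (r / 16 ^ N + 1) = ((1 * r + (C + 16 ^ N) : ℤ) : ℝ) / 16 ^ N := by
    push_cast; field_simp; ring
  refine ⟨_, hR, ?_, ?_, ?_, ?_⟩
  · rw [em]
    refine intCast_div_mem_digitSet (by norm_num) (by norm_num) ?_ fun j hj hi => ?_
    · rw [← em]; exact ⟨by linarith [hR.2, hA.1], by linarith [hR.1, hA.2]⟩
    · have := h2 j hj
      have hj : j % 4 = 3 := by omega
      simpa [s, a, hj] using this
  · rw [ep]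
    refine intCast_div_mem_digitSet (by norm_num) (by norm_num) ?_ fun j hj hi => ?_
    · rw [← ep]; exact ⟨by linarith [hR.1, hA.1], by linarith [hR.2, hA.2]⟩
    · have := h2 j hj
      have hj : j % 4 = 2 := by omega
      simpa [s, a, hj] using this
  · rw [em]
    refine intCast_div_mem_digitSet (by norm_num) (by norm_num) ?_ fun j hj hi => ?_
    · rw [← em]; exact ⟨by linarith [hR.2, hB.1], by linarith [hR.1, hB.2]⟩
    · have := h2 j hj
      have hj : j % 4 = 1 := by omega
      simpa [s, a, hj] using this
  · rw [ep]
    refine intCast_div_mem_digitSet (by norm_num) (by norm_num) ?_ fun j hj hi => ?_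
    · rw [← ep]; exact ⟨by linarith [hR.1, hB.1], by linarith [hR.2, hB.2]⟩
    · have := h2 j hj
      have hj : j % 4 = 0 := by omega
      simpa [s, a, hj] using this

/-- Approximate the center by dyadic points and pass to a convergent subsequence of radii in `[1,
2]`. The digit sets are not closed, hence the closures. -/
theorem exists_radius_closure_digitSet {a b : ℝ} (ha : a ∈ Icc (0 : ℝ) 1) (hb : b ∈ Icc (0 : ℝ) 1) :
    ∃ R ∈ Icc (1 : ℝ) 2, a - R ∈ closure (digitSet 1) ∧ a + R ∈ closure (digitSet 2) ∧
      b - R ∈ closure (digitSet 3) ∧ b + R ∈ closure (digitSet 4) := by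
  have hpow : Tendsto (fun N : ℕ => (16 : ℝ) ^ N) atTop atTop :=
    tendsto_pow_atTop_atTop_of_one_lt (by norm_num)
  have approx {x : ℝ} (hx : x ∈ Icc (0 : ℝ) 1) :
      Tendsto (fun N : ℕ => ((⌊x * 16 ^ N⌋₊ : ℤ) : ℝ) / 16 ^ N) atTop (𝓝 x) := by
    simpa [Function.comp_def] using (tendsto_nat_floor_mul_div_atTop hx.1).comp hpow
  have range {x : ℝ} (hx : x ∈ Icc (0 : ℝ) 1) (N : ℕ) :
      ((⌊x * 16 ^ N⌋₊ : ℤ) : ℝ) / 16 ^ N ∈ Icc (0 : ℝ) 1 := by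
    have hp : (0 : ℝ) < 16 ^ N := by positivity
    refine ⟨by positivity, (div_le_one hp).2 ?_⟩
    have h1 := Nat.floor_le (mul_nonneg hx.1 hp.le)
    have h2 := mul_le_of_le_one_left hp.le hx.2
    simpa using h1.trans h2
  choose R hR h1 h2 h3 h4 using fun N => exists_dyadic_digitSet _ _ N (range ha N) (range hb N)
  obtain ⟨r, hr, φ, hφ, hlim⟩ := isCompact_Icc.tendsto_subseq hR
  have ha' := (approx ha).comp hφ.tendsto_atTop
  have hb' := (approx hb).comp hφ.tendsto_atTop
  exact ⟨r, hr, mem_closure_of_tendsto (ha'.sub hlim) (Eventually.of_forall fun N => h1 _),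
    mem_closure_of_tendsto (ha'.add hlim) (Eventually.of_forall fun N => h2 _),
    mem_closure_of_tendsto (hb'.sub hlim) (Eventually.of_forall fun N => h3 _),
    mem_closure_of_tendsto (hb'.add hlim) (Eventually.of_forall fun N => h4 _)⟩

/-- Each further hexadecimal digit has one prescribed zero bit, which leaves 8 of 16 values; the
initial 8 counts the integer parts in `[-3, 4]`. -/
theorem exists_finset_floor_digitSet {i : ℕ} (h1 : 1 ≤ i) (h4 : i ≤ 4) (N : ℕ) :
    ∃ G : Finset ℤ, G.card ≤ 8 * 8 ^ N ∧ ∀ x ∈ digitSet i, ⌊x * 16 ^ N⌋ ∈ G := by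
  induction N with
  | zero =>
    refine ⟨Finset.Icc (-3) 4, by simp, fun x hx => ?_⟩
    rw [pow_zero, mul_one, Finset.mem_Icc]
    refine ⟨Int.le_floor.2 (by exact_mod_cast hx.1.1), ?_⟩
    have := (Int.floor_le x).trans hx.1.2
    exact_mod_cast this
  | succ N ih =>
    obtain ⟨G, hG, hmem⟩ := ih
    let D : Finset ℤ := (Finset.Ico (0 : ℤ) 16).filter fun e => Even (e / 2 ^ (4 - i))
    have hD : D.card = 8 := by
      simp only [D]
      interval_cases i <;> decide
    refine ⟨(G ×ˢ D).image fun z => 16 * z.1 + z.2, ?_, fun x hx => ?_⟩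
    · refine Finset.card_image_le.trans ?_
      rw [Finset.card_product, hD, pow_succ]
      omega
    · have e1 : ⌊x * 16 ^ (N + 1)⌋ / 16 = ⌊x * 16 ^ N⌋ := by
        have := Int.floor_div_natCast (x * 16 ^ (N + 1)) 16
        push_cast at this
        rw [← this]
        congr 1
        ring
      have e2 : Even (⌊x * 16 ^ (N + 1)⌋ / 2 ^ (4 - i)) := by
        have h := hx.2 N
        have := Int.floor_div_natCast (x * 16 ^ (N + 1)) (2 ^ (4 - i))
        push_cast at this
        have e16 : (16 : ℝ) ^ (N + 1) = 2 ^ (4 * N + i) * 2 ^ (4 - i) := by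
          rw [← pow_add, show 4 * N + i + (4 - i) = 4 * (N + 1) by omega, pow_mul]
          norm_num
        have e : x * 16 ^ (N + 1) / 2 ^ (4 - i) = 2 ^ (4 * N + i) * x := by
          rw [e16]
          field_simp
        rw [← this, e]
        exact h
      refine Finset.mem_image.2 ⟨(⌊x * 16 ^ N⌋, ⌊x * 16 ^ (N + 1)⌋ % 16),
        Finset.mem_product.2 ⟨hmem x hx, Finset.mem_filter.2 ⟨?_, ?_⟩⟩, ?_⟩
      · rw [Finset.mem_Ico]
        dsimp only
        omega
      · dsimp only
        generalize ⌊x * 16 ^ (N + 1)⌋ = n at e2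
        rw [Int.even_iff] at e2 ⊢
        interval_cases i <;> norm_num at e2 ⊢ <;> omega
      · dsimp only
        omega

/-! ### The extremal compact set and its covering numbers -/

/-- The coordinates of the sides in the small set of square boundaries. -/
def sideSet : Set ℝ := ⋃ i ∈ Finset.Icc 1 4, closure (digitSet i)

/-- A small compact set that contains a square boundary around each point of the unit square. -/
def smallSquareSet : Set Plane :=
  {p | (p 0 ∈ sideSet ∧ p 1 ∈ Icc (-3 : ℝ) 4) ∨ (p 0 ∈ Icc (-3 : ℝ) 4 ∧ p 1 ∈ sideSet)}

theorem isClosed_sideSet : IsClosed sideSet :=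
  isClosed_biUnion_finset fun _ _ => isClosed_closure

theorem sideSet_subset : sideSet ⊆ Icc (-3 : ℝ) 4 :=
  iUnion₂_subset fun _ _ => closure_minimal (fun _ hx => hx.1) isClosed_Icc

theorem isCompact_smallSquareSet : IsCompact smallSquareSet := by
  have hK : IsCompact ((EuclideanSpace.equiv (Fin 2) ℝ).toHomeomorph ⁻¹'
      (univ.pi fun _ => Icc (-3 : ℝ) 4)) :=
    (Homeomorph.isCompact_preimage _).2 (isCompact_univ_pi fun _ => isCompact_Icc)
  have hc (i : Fin 2) : Continuous fun p : Plane => p i := by fun_prop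
  refine hK.of_isClosed_subset ?_ ?_
  · exact ((isClosed_sideSet.preimage (hc 0)).inter (isClosed_Icc.preimage (hc 1))).union
      ((isClosed_Icc.preimage (hc 0)).inter (isClosed_sideSet.preimage (hc 1)))
  · rintro p hp i -
    rcases hp with ⟨h0, h1⟩ | ⟨h0, h1⟩ <;> fin_cases i
    · exact sideSet_subset h0
    · exact h1
    · exact h0
    · exact sideSet_subset h1

theorem containsSquareBoundaries_smallSquareSet :
    ContainsSquareBoundaries smallSquareSet unitSquare := by
  intro x hx
  obtain ⟨R, hR, h1, h2, h3, h4⟩ := exists_radius_closure_digitSet (hx 0) (hx 1)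
  have hside {y : ℝ} {i : ℕ} (hi : i ∈ Finset.Icc 1 4) (hy : y ∈ closure (digitSet i)) :
      y ∈ sideSet := mem_iUnion₂.2 ⟨i, hi, hy⟩
  refine ⟨R, by linarith [hR.1], ?_⟩
  rintro _ ⟨t, ht, rfl⟩
  obtain ⟨ht, i, hi⟩ := mem_unitSquareBoundary.1 ht
  have hmem (j : Fin 2) : (x + R • t) j ∈ Icc (-3 : ℝ) 4 := by
    simp only [PiLp.add_apply, PiLp.smul_apply, smul_eq_mul]
    have hR0 : 0 ≤ R := by linarith [hR.1]
    have e1 := mul_le_mul_of_nonneg_left (ht j).1 hR0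
    have e2 := mul_le_mul_of_nonneg_left (ht j).2 hR0
    exact ⟨by linarith [hR.2, (hx j).1], by linarith [hR.2, (hx j).2]⟩
  have e (j : Fin 2) : (x + R • t) j = x j + R * t j := by simp
  fin_cases i
  · refine Or.inl ⟨?_, hmem 1⟩
    dsimp only at hi ⊢
    rw [e 0]
    rcases hi with hi | hi
    · have hi : t 0 = -1 := hi
      rw [hi, mul_neg_one, ← sub_eq_add_neg]
      exact hside (by decide) h1
    · have hi : t 0 = 1 := hi
      rw [hi, mul_one]
      exact hside (by decide) h2
  · refine Or.inr ⟨hmem 0, ?_⟩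
    dsimp only at hi ⊢
    rw [e 1]
    rcases hi with hi | hi
    · have hi : t 1 = -1 := hi
      rw [hi, mul_neg_one, ← sub_eq_add_neg]
      exact hside (by decide) h3
    · have hi : t 1 = 1 := hi
      rw [hi, mul_one]
      exact hside (by decide) h4

theorem abs_sub_floor_div_le (x : ℝ) (N : ℕ) : |x - ⌊x * 16 ^ N⌋ / 16 ^ N| ≤ 1 / 16 ^ N := by
  have hp : (0 : ℝ) < 16 ^ N := by positivity
  have e : x - ⌊x * 16 ^ N⌋ / 16 ^ N = (x * 16 ^ N - ⌊x * 16 ^ N⌋) / 16 ^ N := by field_simp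
  rw [e, abs_div, abs_of_pos hp]
  gcongr
  rw [abs_le]
  constructor <;> linarith [Int.floor_le (x * 16 ^ N), Int.lt_floor_add_one (x * 16 ^ N)]

theorem exists_finset_near_sideSet (N : ℕ) :
    ∃ G : Finset ℤ, G.card ≤ 32 * 8 ^ N ∧
      ∀ x ∈ sideSet, ∃ g ∈ G, |x - g / 16 ^ N| ≤ 2 / 16 ^ N := by
  have h (i : ℕ) : ∃ G : Finset ℤ, G.card ≤ 8 * 8 ^ N ∧
      (i ∈ Finset.Icc 1 4 → ∀ x ∈ digitSet i, ⌊x * 16 ^ N⌋ ∈ G) := by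
    by_cases hi : i ∈ Finset.Icc 1 4
    · rw [Finset.mem_Icc] at hi
      obtain ⟨G, h1, h2⟩ := exists_finset_floor_digitSet hi.1 hi.2 N
      exact ⟨G, h1, fun _ => h2⟩
    · exact ⟨∅, by simp, fun h => absurd h hi⟩
  choose G hG hmem using h
  refine ⟨(Finset.Icc 1 4).biUnion G, ?_, fun x hx => ?_⟩
  · refine (Finset.card_biUnion_le_card_mul _ _ _ fun i _ => hG i).trans ?_
    rw [Nat.card_Icc]
    omega
  · obtain ⟨i, hi, hx⟩ := mem_iUnion₂.1 hx
    -- Passing from the closure to a nearby point costs one more grid step, hence the error `2 / 16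
    -- ^ N`.
    obtain ⟨y, hy, hxy⟩ := Metric.mem_closure_iff.1 hx (1 / 16 ^ N) (by positivity)
    refine ⟨_, Finset.mem_biUnion.2 ⟨i, hi, hmem i hi y hy⟩, ?_⟩
    rw [Real.dist_eq] at hxy
    calc |x - ⌊y * 16 ^ N⌋ / 16 ^ N| ≤ |x - y| + |y - ⌊y * 16 ^ N⌋ / 16 ^ N| := abs_sub_le _ _ _
      _ ≤ 1 / 16 ^ N + 1 / 16 ^ N := add_le_add hxy.le (abs_sub_floor_div_le y N)
      _ = 2 / 16 ^ N := by ring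

theorem exists_finset_near_Icc (N : ℕ) :
    ∃ G : Finset ℤ, G.card ≤ 8 * 16 ^ N ∧
      ∀ x ∈ Icc (-3 : ℝ) 4, ∃ g ∈ G, |x - g / 16 ^ N| ≤ 2 / 16 ^ N := by
  refine ⟨Finset.Icc (-3 * 16 ^ N) (4 * 16 ^ N), ?_, fun x hx => ⟨⌊x * 16 ^ N⌋, ?_, ?_⟩⟩
  · rw [Int.card_Icc]
    have h1 : (1 : ℤ) ≤ 16 ^ N := one_le_pow₀ (by norm_num)
    zify
    rw [Int.toNat_of_nonneg (by linarith)]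
    linarith
  · have hp : (0 : ℝ) < 16 ^ N := by positivity
    rw [Finset.mem_Icc]
    constructor
    · rw [Int.le_floor]
      push_cast
      exact mul_le_mul_of_nonneg_right hx.1 hp.le
    · have := (Int.floor_le (x * 16 ^ N)).trans (mul_le_mul_of_nonneg_right hx.2 hp.le)
      exact_mod_cast this
  · refine (abs_sub_floor_div_le x N).trans ?_
    gcongr
    norm_num

theorem dist_plane_le {p : Plane} {a b ε : ℝ} (h0 : |p 0 - a| ≤ ε) (h1 : |p 1 - b| ≤ ε) :
    dist p !₂[a, b] ≤ 2 * ε := by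
  have hε : 0 ≤ ε := (abs_nonneg _).trans h0
  rw [EuclideanSpace.dist_eq, Fin.sum_univ_two]
  refine Real.sqrt_le_iff.2 ⟨by positivity, ?_⟩
  have e0 : dist (p 0) (!₂[a, b] 0) ≤ ε := h0
  have e1 : dist (p 1) (!₂[a, b] 1) ≤ ε := h1
  have := pow_le_pow_left₀ dist_nonneg e0 2
  have := pow_le_pow_left₀ dist_nonneg e1 2
  nlinarith

theorem externalCoveringNumber_smallSquareSet_le {δ : ℝ≥0} {N : ℕ} (h : 4 / 16 ^ N ≤ (δ : ℝ)) :
    Metric.externalCoveringNumber δ smallSquareSet ≤ ((512 * 128 ^ N : ℕ) : ℕ∞) := by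
  classical
  obtain ⟨G, hG, hGm⟩ := exists_finset_near_sideSet N
  obtain ⟨H, hH, hHm⟩ := exists_finset_near_Icc N
  let f : ℤ × ℤ → Plane := fun z => !₂[(z.1 : ℝ) / 16 ^ N, (z.2 : ℝ) / 16 ^ N]
  let F : Finset Plane := (G ×ˢ H ∪ H ×ˢ G).image f
  have hF : F.card ≤ 512 * 128 ^ N := by
    refine Finset.card_image_le.trans ((Finset.card_union_le _ _).trans ?_)
    rw [Finset.card_product, Finset.card_product]
    have h1 := Nat.mul_le_mul hG hH
    have h2 : (128 : ℕ) ^ N = 8 ^ N * 16 ^ N := by rw [← mul_pow]; norm_num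
    rw [h2]
    nlinarith
  have hcov : Metric.IsCover δ smallSquareSet (F : Set Plane) := by
    have key (p : Plane) (g k : ℤ) (hg : |p 0 - g / 16 ^ N| ≤ 2 / 16 ^ N)
        (hk : |p 1 - k / 16 ^ N| ≤ 2 / 16 ^ N) : edist p (f (g, k)) ≤ δ := by
      have h1 : dist p (f (g, k)) ≤ δ := by
        refine (dist_plane_le hg hk).trans (le_trans (le_of_eq ?_) h)
        ring
      rw [edist_nndist]
      exact_mod_cast h1
    rintro p (⟨h0, h1⟩ | ⟨h0, h1⟩)
    · obtain ⟨g, hg, hg'⟩ := hGm _ h0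
      obtain ⟨k, hk, hk'⟩ := hHm _ h1
      exact ⟨f (g, k), Finset.mem_image_of_mem _
        (Finset.mem_union_left _ (Finset.mem_product.2 ⟨hg, hk⟩)), key p g k hg' hk'⟩
    · obtain ⟨g, hg, hg'⟩ := hHm _ h0
      obtain ⟨k, hk, hk'⟩ := hGm _ h1
      exact ⟨f (g, k), Finset.mem_image_of_mem _
        (Finset.mem_union_right _ (Finset.mem_product.2 ⟨hg, hk⟩)), key p g k hg' hk'⟩
  refine hcov.externalCoveringNumber_le_encard.trans ?_
  rw [Set.encard_coe_eq_coe_finsetCard]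
  exact_mod_cast hF

theorem upperBoxDim_smallSquareSet_le : upperBoxDim smallSquareSet ≤ ((7 / 4 : ℝ) : EReal) := by
  refine upperBoxDim_le (c := 512 * 64 ^ (7 / 4 : ℝ)) (by positivity) ?_
  filter_upwards [eventually_pos_log_one_div] with δ hδ
  have hδ0 : 0 < (δ : ℝ) := NNReal.coe_pos.2 hδ.1
  have hδ1 : (δ : ℝ) < 1 := by
    have := (Real.log_pos_iff (by positivity)).1 hδ.2
    rwa [one_div, one_lt_inv₀ hδ0] at this
  -- The power `16 ^ (n + 1)` is the first above `4 / δ`, so it is at most `64 / δ`; the exponent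
  -- `7/4` enters through `128 = 16 ^ (7/4)`.
  obtain ⟨n, h1, h2⟩ := exists_nat_pow_near (x := 4 / (δ : ℝ)) (y := 16)
    (by rw [le_div_iff₀ hδ0]; linarith) (by norm_num)
  have h3 : 4 / 16 ^ (n + 1) ≤ (δ : ℝ) := by
    rw [div_lt_iff₀ hδ0] at h2
    rw [div_le_iff₀ (by positivity)]
    linarith
  have h4 : (16 : ℝ) ^ (n + 1) ≤ 64 / δ := by
    rw [le_div_iff₀ hδ0] at h1 ⊢
    rw [pow_succ]
    linarith
  have h5 : (128 : ℝ) ^ (n + 1) ≤ 64 ^ (7 / 4 : ℝ) * (δ : ℝ) ^ (-(7 / 4) : ℝ) := by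
    have e : (128 : ℝ) ^ (n + 1) = ((16 : ℝ) ^ (n + 1)) ^ (7 / 4 : ℝ) := by
      rw [← Real.rpow_natCast, ← Real.rpow_natCast, ← Real.rpow_mul (by norm_num), mul_comm,
        Real.rpow_mul (by norm_num)]
      congr 1
      rw [show (16 : ℝ) = 2 ^ (4 : ℝ) by norm_num, ← Real.rpow_mul (by norm_num)]
      norm_num
    rw [e, Real.rpow_neg hδ0.le, ← div_eq_mul_inv, ← Real.div_rpow (by norm_num) hδ0.le]
    exact Real.rpow_le_rpow (by positivity) h4 (by norm_num)
  calc (Metric.externalCoveringNumber δ smallSquareSet : ℝ≥0∞)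
      ≤ (((512 * 128 ^ (n + 1) : ℕ) : ℕ∞) : ℝ≥0∞) :=
        ENat.toENNReal_le.2 (externalCoveringNumber_smallSquareSet_le h3)
    _ = ENNReal.ofReal ((512 * 128 ^ (n + 1) : ℕ) : ℝ) := by
        rw [ENNReal.ofReal_natCast, ENat.toENNReal_coe]
    _ ≤ _ := by
        refine ENNReal.ofReal_le_ofReal ?_
        push_cast
        rw [mul_assoc]
        gcongr

theorem theoremt :
    (∀ B : Set Plane, ContainsSquareBoundaries B unitSquare →
      ((7 / 4 : ℝ) : EReal) ≤ lowerBoxDim B ∧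
      ((7 / 4 : ℝ) : EReal) ≤ upperBoxDim B ∧
      ((7 / 4 : ℝ) : EReal) ≤ packingDim B) ∧
    (∃ B : Set Plane, IsCompact B ∧ ContainsSquareBoundaries B unitSquare ∧
      lowerBoxDim B = ((7 / 4 : ℝ) : EReal) ∧
      upperBoxDim B = ((7 / 4 : ℝ) : EReal) ∧
      packingDim B = ((7 / 4 : ℝ) : EReal)) := by
  have hlower (B : Set Plane) (hB : ContainsSquareBoundaries B unitSquare) :
      ((7 / 4 : ℝ) : EReal) ≤ lowerBoxDim B ∧ ((7 / 4 : ℝ) : EReal) ≤ upperBoxDim B ∧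
        ((7 / 4 : ℝ) : EReal) ≤ packingDim B :=
    ⟨le_lowerBoxDim_of_containsSquareBoundaries hB,
      (le_lowerBoxDim_of_containsSquareBoundaries hB).trans (lowerBoxDim_le_upperBoxDim B),
      le_packingDim_of_containsSquareBoundaries hB⟩
  obtain ⟨h1, h2, h3⟩ := hlower _ containsSquareBoundaries_smallSquareSet
  have hup := upperBoxDim_smallSquareSet_le
  exact ⟨hlower, smallSquareSet, isCompact_smallSquareSet, containsSquareBoundaries_smallSquareSet,
    ((lowerBoxDim_le_upperBoxDim _).trans hup).antisymm h1, hup.antisymm h2,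
    ((packingDim_le_upperBoxDim _).trans hup).antisymm h3⟩
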